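/- Let $d\ge 1$ be an integer, let $R>0$, and let $B^{2d}(R)=\{z\in\mathbb C^d : |z|\le R\}$ be the closed Euclidean ball of radius $R$ centered at the origin. A unitary plank in $\mathbb C^d$ with cross-section $K$ is a set of the form $U(K\times\mathbb C^{d-1})$, where $K\subseteq\mathbb C$ is Lebesgue measurable and $U$ is a unitary transformation of $\mathbb C^d$; its cross-section area is the area (two-dimensional Lebesgue measure, possibly infinite) of $K$. If $B^{2d}(R)$ is covered by a finite or countably infinite family of unitary planks $P_i=U_i(K_i\times\mathbb C^{d-1})$, then $$\sum_i \operatorname{area}(K_i)\ \ge\ \pi R^2 .$$ -/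

import Mathlib

/-- The cylinder `K × ℂ^(d-1)` in `ℂ^d` over a subset `K` of `ℂ`: no condition is put on the
coordinates other than the first one. -/
def standardPlank (d : ℕ) [NeZero d] (K : Set ℂ) : Set (EuclideanSpace ℂ (Fin d)) :=
  {x | x 0 ∈ K}

/-- The unitary plank with cross-section `K`: the image of the cylinder `K × ℂ^(d-1)` under a
unitary transformation `U` of `ℂ^d`. -/
def unitaryPlank {d : ℕ} [NeZero d]
    (U : EuclideanSpace ℂ (Fin d) ≃ₗᵢ[ℂ] EuclideanSpace ℂ (Fin d)) (K : Set ℂ) :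
    Set (EuclideanSpace ℂ (Fin d)) :=
  U '' standardPlank d K

/-!
The proof is potential-theoretic. Outer regularity and compactness of the ball reduce the claim to
finitely many planks `{z | L i z ∈ K i}` with `K i` open and bounded, where `L i` is a linear
functional of norm one. Suppose that the total area `A` of the `K i` is less than `π R ^ 2`. Put
`u z = ∑ i, ∫ w in K i, log ‖L i z - w‖`. This function is continuous and plurisubharmonic, it
grows at most like `A * log ‖z‖`, and inside the `i`-th plank its Laplacian along a complex line
on which `L i` is an isometry is at least `2π`.

Subtract from `2 * u` a radial function `ψ` which is `B * ‖z‖ ^ 2 / R ^ 2` on the ball, with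
`A < B < π R ^ 2`, and which outside the ball is strictly superharmonic in the radial complex
direction and grows like `2 * B' * log ‖z‖`, with `A < B' < B`. Since `B' > A`, the difference
attains its maximum.

* The maximum is not attained outside the ball: on the analytic disc `t ↦ (1 + t)⁻¹ • z₀` the
  difference is strictly subharmonic (`norm_le_of_forall_le`).
* It is not attained at a point of the ball in a plank: transversally to this plank the Laplacian
  of `2 * u` is at least `4π`, that of `ψ` at most `4 * B / R ^ 2 < 4π`
  (`notMem_of_forall_le_of_norm_le`).

So a maximum point lies in the ball and in no plank. Laplacians are replaced throughout by averages
over small circles, which for `log ‖f‖` with `f` analytic are given by Jensen's formula.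
-/

open MeasureTheory Metric Set Filter Topology
open Real (circleAverage)

/-! ### The logarithmic kernel in the plane -/

/-- The kernel as a continuous truncation, equal to `log s` on the disc of radius `s`, minus a
nonnegative function supported in that disc. -/
theorem log_norm_eq_sub_posLog {s : ℝ} (hs : 0 < s) {z : ℂ} (hz : z ≠ 0) :
    Real.log ‖z‖ = Real.log s + Real.posLog (s⁻¹ * ‖z‖) - Real.posLog (s / ‖z‖) := by
  have hz' : ‖z‖ ≠ 0 := norm_ne_zero_iff.mpr hz
  have h := Real.posLog_sub_posLog_inv (x := s⁻¹ * ‖z‖)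
  rw [Real.log_mul (inv_ne_zero hs.ne') hz', Real.log_inv, mul_inv, inv_inv, ← div_eq_mul_inv] at h
  linarith

/-- The integrand of `z ↦ log⁺ (s / ‖z‖)` in polar coordinates, with Jacobian `y ^ (2 - 1)`. -/
theorem radial_posLog_eq_indicator {s : ℝ} (hs : 0 < s) :
    EqOn (fun y : ℝ => y ^ (2 - 1) • Real.posLog (s / y))
      ((Ioc 0 s).indicator fun y => y * Real.log s - y * Real.log y) (Ioi 0) := by
  intro y hy
  have hy : 0 < y := hy
  by_cases h : y ≤ s
  · have h1 : 1 ≤ |s / y| := by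
      rw [abs_of_pos (by positivity), le_div_iff₀ hy]; linarith
    simp [indicator_of_mem (show y ∈ Ioc 0 s from ⟨hy, h⟩), Real.posLog_eq_log h1,
      Real.log_div hs.ne' hy.ne', mul_sub]
  · have h1 : Real.posLog (s / y) = 0 := by
      rw [Real.posLog_eq_zero_iff, abs_of_pos (by positivity), div_le_one hy]
      linarith
    simp [h1, h]

theorem integrable_posLog_div_norm {s : ℝ} (hs : 0 < s) :
    Integrable (fun z : ℂ => Real.posLog (s / ‖z‖)) := by
  rw [integrable_fun_norm_addHaar (E := ℂ) volume (f := fun y => Real.posLog (s / y)),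
    Complex.finrank_real_complex, integrableOn_congr_fun (radial_posLog_eq_indicator hs)
      measurableSet_Ioi]
  refine Integrable.integrableOn ?_
  rw [integrable_indicator_iff measurableSet_Ioc]
  have hc : Continuous fun y : ℝ => y * Real.log s - y * Real.log y :=
    (by fun_prop : Continuous fun y : ℝ => y * Real.log s).sub Real.continuous_mul_log
  exact hc.continuousOn.integrableOn_Icc.mono_set Ioc_subset_Icc_self

/-- The gain in Jensen's formula on a circle of radius `s`, integrated over the plane. -/
theorem integral_posLog_div_norm {s : ℝ} (hs : 0 < s) :
    ∫ z : ℂ, Real.posLog (s / ‖z‖) = Real.pi * s ^ 2 / 2 := by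
  have hc : Continuous fun y : ℝ => y * Real.log s - y * Real.log y :=
    (by fun_prop : Continuous fun y : ℝ => y * Real.log s).sub Real.continuous_mul_log
  have hint : ∫ y in (0:ℝ)..s, (y * Real.log s - y * Real.log y) = s ^ 2 / 4 := by
    rw [intervalIntegral.integral_eq_sub_of_hasDerivAt_of_le hs.le
      (f := fun y => y ^ 2 / 2 * Real.log s - y * (y * Real.log y) / 2 + y ^ 2 / 4)]
    · simp; ring
    · have := Real.continuous_mul_log
      exact (by fun_prop : Continuous fun y : ℝ =>
        y ^ 2 / 2 * Real.log s - y * (y * Real.log y) / 2 + y ^ 2 / 4).continuousOn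
    · intro y hy
      have hy0 : y ≠ 0 := hy.1.ne'
      have h1 := ((hasDerivAt_id y).mul (Real.hasDerivAt_mul_log hy0)).div_const 2
      have h2 := ((hasDerivAt_pow 2 y).div_const 2).mul_const (Real.log s)
      have h3 := (hasDerivAt_pow 2 y).div_const 4
      convert (h2.sub h1).add h3 using 1
      · ext y; simp
      · simp; ring
    · exact hc.intervalIntegrable _ _
  rw [integral_fun_norm_addHaar (E := ℂ) volume (fun y => Real.posLog (s / y)),
    Complex.finrank_real_complex, setIntegral_congr_fun measurableSet_Ioi
      (radial_posLog_eq_indicator hs), setIntegral_indicator measurableSet_Ioc,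
    inter_eq_right.mpr (fun y hy => hy.1), ← intervalIntegral.integral_of_le hs.le, hint]
  simp [Measure.real, Complex.volume_ball]
  ring

theorem integrable_posLog_div_norm_sub {s : ℝ} (hs : 0 < s) (a : ℂ) :
    Integrable (fun w : ℂ => Real.posLog (s / ‖a - w‖)) :=
  (integrable_posLog_div_norm hs).comp_sub_left a

theorem integral_posLog_div_norm_sub {s : ℝ} (hs : 0 < s) (a : ℂ) :
    ∫ w : ℂ, Real.posLog (s / ‖a - w‖) = Real.pi * s ^ 2 / 2 := by
  rw [integral_sub_left_eq_self (fun z : ℂ => Real.posLog (s / ‖z‖)) volume a,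
    integral_posLog_div_norm hs]

theorem setIntegral_posLog_le {s : ℝ} (hs : 0 < s) (a : ℂ) (K : Set ℂ) :
    ∫ w in K, Real.posLog (s / ‖a - w‖) ≤ Real.pi * s ^ 2 / 2 := by
  rw [← integral_posLog_div_norm_sub hs a]
  exact setIntegral_le_integral (integrable_posLog_div_norm_sub hs a)
    (ae_of_all _ fun _ => Real.posLog_nonneg)

theorem setIntegral_posLog_eq {s : ℝ} (hs : 0 < s) {a : ℂ} {K : Set ℂ}
    (hK : closedBall a s ⊆ K) :
    ∫ w in K, Real.posLog (s / ‖a - w‖) = Real.pi * s ^ 2 / 2 := by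
  rw [← integral_posLog_div_norm_sub hs a]
  refine setIntegral_eq_integral_of_forall_compl_eq_zero fun w hw => ?_
  have h : s < ‖a - w‖ := by
    by_contra! h
    exact hw (hK (by rwa [mem_closedBall, dist_eq_norm, norm_sub_rev]))
  rw [Real.posLog_eq_zero_iff, abs_of_nonneg (by positivity), div_le_one (hs.trans h)]
  exact h.le

theorem ae_sub_ne_zero (a : ℂ) (K : Set ℂ) : ∀ᵐ w ∂volume.restrict K, a - w ≠ 0 := by
  refine ae_restrict_of_ae ?_
  have : ({a}ᶜ : Set ℂ) ∈ ae (volume : Measure ℂ) := compl_mem_ae_iff.mpr (measure_singleton a)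
  filter_upwards [this] with w hw h
  exact hw (sub_eq_zero.mp h).symm

/-! ### The logarithmic potential of a bounded set -/

/-- The logarithmic potential at `a` of the restriction of the area measure to `K`. -/
noncomputable def logPotential (K : Set ℂ) (a : ℂ) : ℝ :=
  ∫ w in K, Real.log ‖a - w‖

theorem integrableOn_posLog_mul {K : Set ℂ} (hK : Bornology.IsBounded K) (c : ℝ) (a : ℂ) :
    IntegrableOn (fun w => Real.posLog (c * ‖a - w‖)) K := by
  have hc : Continuous fun w : ℂ => Real.posLog (c * ‖a - w‖) :=
    Real.continuous_posLog.comp (by fun_prop)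
  obtain ⟨M, hM⟩ := hK.subset_closedBall 0
  exact (hc.continuousOn.integrableOn_compact (isCompact_closedBall 0 M)).mono_set hM

theorem integrableOn_log_norm_sub {K : Set ℂ} (hK : Bornology.IsBounded K) (a : ℂ) :
    IntegrableOn (fun w => Real.log ‖a - w‖) K := by
  have h1 := integrableOn_posLog_mul hK 1 a
  have h2 := (integrable_posLog_div_norm_sub one_pos a).integrableOn (s := K)
  refine (h1.sub h2).congr (ae_of_all _ fun w => ?_)
  simp [← Real.posLog_sub_posLog_inv (x := ‖a - w‖)]

theorem setIntegral_abs_log_le {K : Set ℂ} {M : ℝ} (hKm : MeasurableSet K) (hK : K ⊆ closedBall 0 M) (a : ℂ) :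
    ∫ w in K, |Real.log ‖a - w‖| ≤
      volume.real K * Real.posLog (‖a‖ + M) + Real.pi / 2 := by
  have hb : Bornology.IsBounded K := isBounded_closedBall.subset hK
  have hfin : volume K ≠ ⊤ := (hb.measure_lt_top).ne
  have h1 := integrableOn_posLog_mul hb 1 a
  have h2 := (integrable_posLog_div_norm_sub one_pos a).integrableOn (s := K)
  have hle : ∫ w in K, Real.posLog (1 * ‖a - w‖) ≤ volume.real K * Real.posLog (‖a‖ + M) := by
    calc ∫ w in K, Real.posLog (1 * ‖a - w‖) ≤ ∫ w in K, Real.posLog (‖a‖ + M) := by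
          refine setIntegral_mono_on h1 (integrableOn_const hfin) hKm fun w hw => ?_
          refine Real.posLog_le_posLog (by positivity) ?_
          have := mem_closedBall_zero_iff.mp (hK hw)
          linarith [norm_sub_le a w]
      _ = _ := by simp
  calc ∫ w in K, |Real.log ‖a - w‖|
      ≤ ∫ w in K, (Real.posLog (1 * ‖a - w‖) + Real.posLog (1 / ‖a - w‖)) := by
        refine integral_mono (integrableOn_log_norm_sub hb a).abs (h1.add h2) fun w => ?_
        simp only [one_mul, one_div]
        rw [← Real.posLog_sub_posLog_inv (x := ‖a - w‖)]
        have := Real.posLog_nonneg (x := ‖a - w‖)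
        have := Real.posLog_nonneg (x := ‖a - w‖⁻¹)
        exact abs_le.mpr ⟨by linarith, by linarith⟩
    _ ≤ _ := by
        rw [integral_add h1 h2]
        have := setIntegral_posLog_le one_pos a K
        linarith

theorem integrableOn_truncated_log {K : Set ℂ} (hK : Bornology.IsBounded K) (s : ℝ) (a : ℂ) :
    IntegrableOn (fun w => Real.log s + Real.posLog (s⁻¹ * ‖a - w‖)) K :=
  (integrableOn_const (C := Real.log s) hK.measure_lt_top.ne).add
    (integrableOn_posLog_mul hK s⁻¹ a)

theorem logPotential_eq_sub {K : Set ℂ} (hK : Bornology.IsBounded K) {s : ℝ} (hs : 0 < s)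
    (a : ℂ) :
    logPotential K a = (∫ w in K, (Real.log s + Real.posLog (s⁻¹ * ‖a - w‖))) -
      ∫ w in K, Real.posLog (s / ‖a - w‖) := by
  rw [logPotential, ← integral_sub (integrableOn_truncated_log hK s a)
    (integrable_posLog_div_norm_sub hs a).integrableOn]
  refine integral_congr_ae ?_
  filter_upwards [ae_sub_ne_zero a K] with w hw using log_norm_eq_sub_posLog hs hw

/-- The truncated potentials are continuous and approximate the potential uniformly, because the
truncation error is at most `π s ^ 2 / 2` at every point. -/
theorem continuous_logPotential {K : Set ℂ} (hKm : MeasurableSet K)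
    (hK : Bornology.IsBounded K) : Continuous (logPotential K) := by
  have hfin : volume K ≠ ⊤ := (hK.measure_lt_top).ne
  obtain ⟨M, hM⟩ := hK.subset_closedBall 0
  refine continuous_of_uniform_approx_of_continuous fun u hu => ?_
  obtain ⟨ε, hε, hεu⟩ := Metric.mem_uniformity_dist.mp hu
  obtain ⟨s, hs, hsε⟩ : ∃ s : ℝ, 0 < s ∧ Real.pi * s ^ 2 / 2 < ε := by
    refine ⟨Real.sqrt (ε / Real.pi), Real.sqrt_pos.mpr (by positivity), ?_⟩
    rw [Real.sq_sqrt (by positivity)]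
    field_simp
    norm_num
  refine ⟨fun a => ∫ w in K, (Real.log s + Real.posLog (s⁻¹ * ‖a - w‖)), ?_, fun a => hεu ?_⟩
  · refine continuous_iff_continuousAt.mpr fun a₀ => ?_
    refine continuousAt_of_dominated
      (bound := fun _ => |Real.log s| + Real.posLog (s⁻¹ * (‖a₀‖ + 1 + M))) ?_ ?_ ?_ ?_
    · refine Eventually.of_forall fun a => ?_
      exact (integrableOn_truncated_log hK s a).aestronglyMeasurable
    · filter_upwards [closedBall_mem_nhds a₀ one_pos] with a ha
      refine (ae_restrict_iff' hKm).mpr (ae_of_all _ fun w hw => ?_)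
      refine (norm_add_le _ _).trans (add_le_add le_rfl ?_)
      rw [Real.norm_of_nonneg Real.posLog_nonneg]
      refine Real.posLog_le_posLog (by positivity) ?_
      gcongr
      have h1 := mem_closedBall_zero_iff.mp (hM hw)
      have h2 : ‖a - a₀‖ ≤ 1 := by simpa [dist_eq_norm] using ha
      have h3 := norm_sub_le a w
      have h4 := norm_le_norm_add_norm_sub' a a₀
      linarith
    · exact integrableOn_const hfin
    · refine ae_of_all _ fun w => Continuous.continuousAt ?_
      exact continuous_const.add (Real.continuous_posLog.comp (by fun_prop))
  · rw [logPotential_eq_sub hK hs, Real.dist_eq]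
    beta_reduce
    rw [sub_sub_cancel_left, abs_neg,
      abs_of_nonneg (integral_nonneg fun _ => Real.posLog_nonneg)]
    exact (setIntegral_posLog_le hs a K).trans_lt hsε

theorem logPotential_le {K : Set ℂ} (hKm : MeasurableSet K) {M : ℝ} (hK : K ⊆ closedBall 0 M)
    (a : ℂ) (ha : 1 ≤ ‖a‖ + M) : logPotential K a ≤ volume.real K * Real.log (‖a‖ + M) := by
  have hb : Bornology.IsBounded K := isBounded_closedBall.subset hK
  calc logPotential K a ≤ ∫ w in K, Real.log (‖a‖ + M) := by
        refine setIntegral_mono_on (integrableOn_log_norm_sub hb a)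
          (integrableOn_const hb.measure_lt_top.ne) hKm fun w hw => ?_
        have h1 := mem_closedBall_zero_iff.mp (hK hw)
        have h2 := norm_sub_le a w
        rcases eq_or_ne (a - w) 0 with h | h
        · simpa [h] using Real.log_nonneg ha
        · exact Real.log_le_log (norm_pos_iff.mpr h) (by linarith)
    _ = _ := by simp

/-! ### Circle averages of logarithmic potentials -/

/-- The integrability needed to exchange the potential with an average along a curve. -/
theorem integrable_log_norm_sub_prod {K : Set ℂ} (hKm : MeasurableSet K)
    (hK : Bornology.IsBounded K) {γ : ℝ → ℂ} (hγ : Continuous γ) (a b : ℝ) :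
    Integrable (fun p : ℝ × ℂ => Real.log ‖γ p.1 - p.2‖)
      ((volume.restrict (uIoc a b)).prod (volume.restrict K)) := by
  have hmeas : Measurable fun p : ℝ × ℂ => Real.log ‖γ p.1 - p.2‖ := by
    have := hγ.measurable
    fun_prop
  obtain ⟨M, hM⟩ := hK.subset_closedBall 0
  obtain ⟨C, hC⟩ := (isCompact_uIcc (a := a) (b := b)).exists_bound_of_continuousOn hγ.continuousOn
  have hfin : IsFiniteMeasure (volume.restrict K) := ⟨by simpa using hK.measure_lt_top⟩
  refine (integrable_prod_iff hmeas.aestronglyMeasurable).mpr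
    ⟨ae_of_all _ fun θ => integrableOn_log_norm_sub hK (γ θ), ?_⟩
  have hfin' : IsFiniteMeasure (volume.restrict (uIoc a b)) := ⟨by simp [uIoc]⟩
  refine Integrable.of_bound
    hmeas.norm.stronglyMeasurable.integral_prod_right'.aestronglyMeasurable
    (volume.real K * Real.posLog (C + |M|) + Real.pi / 2) ?_
  refine (ae_restrict_iff' measurableSet_uIoc).mpr (ae_of_all _ fun θ hθ => ?_)
  rw [Real.norm_of_nonneg (integral_nonneg fun _ => norm_nonneg _)]
  refine (setIntegral_abs_log_le hKm (hM.trans (closedBall_subset_closedBall (le_abs_self M)))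
    (γ θ)).trans ?_
  have := hC θ (uIoc_subset_uIcc hθ)
  have := Real.posLog_le_posLog (x := ‖γ θ‖ + |M|) (y := C + |M|) (by positivity) (by linarith)
  gcongr ?_ * ?_ + _

theorem circleAverage_logPotential_comp {K : Set ℂ} (hKm : MeasurableSet K)
    (hK : Bornology.IsBounded K) {γ : ℂ → ℂ} {c : ℂ} {s : ℝ}
    (hγ : Continuous fun θ => γ (circleMap c s θ)) :
    circleAverage (fun t => logPotential K (γ t)) c s =
      ∫ w in K, circleAverage (fun t => Real.log ‖γ t - w‖) c s := by
  have hint := integrable_log_norm_sub_prod hKm hK hγ 0 (2 * Real.pi)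
  simp only [Real.circleAverage_def, logPotential]
  simp only [smul_eq_mul]
  rw [integral_const_mul]
  congr 1
  simp only [intervalIntegral.integral_of_le Real.two_pi_pos.le]
  rw [uIoc_of_le Real.two_pi_pos.le] at hint
  exact integral_integral_swap hint

theorem integrableOn_circleAverage_log_norm_sub {K : Set ℂ} (hKm : MeasurableSet K)
    (hK : Bornology.IsBounded K) {γ : ℂ → ℂ} {c : ℂ} {s : ℝ}
    (hγ : Continuous fun θ => γ (circleMap c s θ)) :
    IntegrableOn (fun w => circleAverage (fun t => Real.log ‖γ t - w‖) c s) K := by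
  have hint := integrable_log_norm_sub_prod hKm hK hγ 0 (2 * Real.pi)
  rw [uIoc_of_le Real.two_pi_pos.le] at hint
  simp only [Real.circleAverage_def, intervalIntegral.integral_of_le Real.two_pi_pos.le]
  exact hint.integral_prod_right.const_mul _

/-- A logarithmic potential inherits a sub-mean value inequality from its kernel. -/
theorem logPotential_le_circleAverage_comp {K : Set ℂ} (hKm : MeasurableSet K)
    (hK : Bornology.IsBounded K) {γ : ℂ → ℂ} {c : ℂ} {s : ℝ}
    (hγ : Continuous fun θ => γ (circleMap c s θ)) {a : ℂ}
    (h : ∀ w, a - w ≠ 0 →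
      Real.log ‖a - w‖ ≤ circleAverage (fun t => Real.log ‖γ t - w‖) c s) :
    logPotential K a ≤ circleAverage (fun t => logPotential K (γ t)) c s := by
  rw [circleAverage_logPotential_comp hKm hK hγ]
  refine integral_mono_ae (integrableOn_log_norm_sub hK a)
    (integrableOn_circleAverage_log_norm_sub hKm hK hγ) ?_
  filter_upwards [ae_sub_ne_zero a K] with w hw using h w hw

/-- The sub-mean value property of `log ‖f‖`: by Jensen's formula the defect is a sum over the
zeros of `f`. -/
theorem log_norm_le_circleAverage {f : ℂ → ℂ} {c : ℂ} {s : ℝ} (hs : 0 < s)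
    (hf : AnalyticOnNhd ℂ f (closedBall c |s|)) (hc : f c ≠ 0) :
    Real.log ‖f c‖ ≤ circleAverage (fun t => Real.log ‖f t‖) c s := by
  rw [hf.circleAverage_log_norm hs.ne' hc]
  refine le_add_of_nonneg_left (finsum_nonneg fun u => ?_)
  by_cases hu : u ∈ closedBall c |s|
  · refine mul_nonneg (by exact_mod_cast MeromorphicOn.AnalyticOnNhd.divisor_nonneg hf u) ?_
    rcases eq_or_ne c u with rfl | hcu
    · simp
    have h : ‖c - u‖ ≤ s := by
      rwa [mem_closedBall, dist_eq_norm, norm_sub_rev, abs_of_pos hs] at hu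
    have h0 : 0 < ‖c - u‖ := norm_pos_iff.mpr (sub_ne_zero.mpr hcu)
    exact Real.log_nonneg (by rw [← div_eq_mul_inv, one_le_div h0]; exact h)
  · simp [Function.locallyFinsuppWithin.apply_eq_zero_of_notMem _ hu]

/-- The strict form of the sub-mean value inequality: around a point inside `K` the potential has
Laplacian `2π`. -/
theorem circleAverage_logPotential_add {K : Set ℂ} (hKm : MeasurableSet K)
    (hK : Bornology.IsBounded K) {a : ℂ} {s : ℝ} (hs : 0 < s) (ha : closedBall a s ⊆ K) :
    circleAverage (fun t => logPotential K (a + t)) 0 s =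
      logPotential K a + Real.pi * s ^ 2 / 2 := by
  rw [circleAverage_logPotential_comp hKm hK (by fun_prop), logPotential_eq_sub hK hs,
    setIntegral_posLog_eq hs ha, sub_add_cancel]
  congr 1 with w
  have h := circleAverage_log_norm_sub_const_eq_log_radius_add_posLog (a := w - a) (c := 0) hs.ne'
  rw [zero_sub, neg_sub] at h
  rw [← h]
  congr 1 with t
  congr 2
  ring

/-! ### Circle averages of elementary functions -/

theorem circleAverage_norm_add_smul_sq {E : Type*} [NormedAddCommGroup E] [InnerProductSpace ℂ E]
    (z v : E) (s : ℝ) :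
    circleAverage (fun t : ℂ => ‖z + t • v‖ ^ 2) 0 s = ‖z‖ ^ 2 + s ^ 2 * ‖v‖ ^ 2 := by
  have hc : Continuous fun t : ℂ => inner ℂ z v * t := by fun_prop
  have hre : circleAverage (fun t : ℂ => (inner ℂ z v * t).re) 0 s = 0 := by
    have h := Complex.reCLM.circleAverage_comp_comm
      (f := fun t : ℂ => inner ℂ z v * t) (c := 0) (R := s) hc.continuousOn.circleIntegrable'
    have hd : DiffContOnCl ℂ (fun t : ℂ => inner ℂ z v * t) (ball 0 |s|) :=
      Differentiable.diffContOnCl (by fun_prop)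
    rw [hd.circleAverage, mul_zero, map_zero] at h
    exact h
  have h : EqOn (fun t : ℂ => ‖z + t • v‖ ^ 2)
      (fun t => (‖z‖ ^ 2 + s ^ 2 * ‖v‖ ^ 2) + (2 : ℝ) • (inner ℂ z v * t).re) (sphere 0 |s|) := by
    intro t ht
    have ht : ‖t‖ = |s| := by simpa using ht
    beta_reduce
    rw [@norm_add_sq ℂ, inner_smul_right, norm_smul, mul_pow, ht, sq_abs, mul_comm t]
    simp only [RCLike.re_to_complex, smul_eq_mul]
    ring
  rw [Real.circleAverage_congr_sphere h, Real.circleAverage_fun_add (circleIntegrable_const _ _ _)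
    (Continuous.continuousOn (by fun_prop)).circleIntegrable', Real.circleAverage_const,
    Real.circleAverage_fun_smul, hre, smul_zero, add_zero]

theorem circleAverage_log_norm_one_add {s : ℝ} (hs : 0 < s) (hs1 : s < 1) :
    circleAverage (fun t : ℂ => Real.log ‖1 + t‖) 0 s = 0 := by
  have h := circleAverage_log_norm_sub_const_eq_log_radius_add_posLog (a := -1) (c := 0) hs.ne'
  have h1 : 1 ≤ |s⁻¹| := by rw [abs_of_pos (by positivity)]; exact (one_lt_inv₀ hs).mpr hs1 |>.le
  simp only [sub_neg_eq_add, zero_add, norm_one, mul_one, Real.posLog_eq_log h1,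
    Real.log_inv, add_neg_cancel] at h
  simpa [add_comm] using h

/-! ### The barrier -/

/-- The radial function subtracted from the potential, in terms of `q = ‖z‖ ^ 2 / R ^ 2`. It is
`B * q` for `q ≤ 1` and `B + B' * log q + (B - B') * (1 - q⁻¹)` for `q ≥ 1`. The two formulas agree
to first order at `q = 1`; the logarithm is harmonic in the radial complex direction, and the last
term makes the function strictly superharmonic there when `B' < B`. -/
noncomputable def barrier (B B' q : ℝ) : ℝ :=
  B * min q 1 + B' * Real.log (max q 1) + (B - B') * (1 - (max q 1)⁻¹)

theorem continuous_barrier (B B' : ℝ) : Continuous (barrier B B') := by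
  have h : ∀ q : ℝ, max q 1 ≠ 0 := fun q => (zero_lt_one.trans_le (le_max_right q 1)).ne'
  have h1 : Continuous fun q : ℝ => Real.log (max q 1) :=
    (continuous_id.max continuous_const).log h
  have h2 : Continuous fun q : ℝ => (max q 1)⁻¹ :=
    (continuous_id.max continuous_const).inv₀ h
  unfold barrier
  fun_prop

theorem barrier_of_le_one {B B' q : ℝ} (hq : q ≤ 1) : barrier B B' q = B * q := by
  simp [barrier, hq]

theorem barrier_of_one_le {B B' q : ℝ} (hq : 1 ≤ q) :
    barrier B B' q = B + B' * Real.log q + (B - B') * (1 - q⁻¹) := by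
  simp [barrier, hq]

theorem barrier_le_mul {B B' : ℝ} (h0 : 0 ≤ B') (hB : B' ≤ B) (q : ℝ) :
    barrier B B' q ≤ B * q := by
  rcases le_total q 1 with hq | hq
  · exact (barrier_of_le_one hq).le
  · have hq0 : 0 < q := by linarith
    have h1 := Real.log_le_sub_one_of_pos hq0
    have h2 := Real.one_sub_inv_le_log_of_pos hq0
    rw [barrier_of_one_le hq]
    nlinarith [mul_le_mul_of_nonneg_left h1 h0,
      mul_le_mul_of_nonneg_left (h2.trans h1) (sub_nonneg.mpr hB)]

/-! ### Planks of small total area miss a point of the ball -/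

section Planks

variable {E : Type*} [NormedAddCommGroup E] [InnerProductSpace ℂ E]
  {ι : Type*} [Fintype ι] {K : ι → Set ℂ} {L : ι → E →L[ℂ] ℂ}

/-- The sum of the logarithmic potentials of the planks `{z | L i z ∈ K i}`. -/
noncomputable def plankPotential (K : ι → Set ℂ) (L : ι → E →L[ℂ] ℂ) (z : E) : ℝ :=
  ∑ i, logPotential (K i) (L i z)

theorem continuous_plankPotential (hKo : ∀ i, IsOpen (K i))
    (hKb : ∀ i, Bornology.IsBounded (K i)) : Continuous (plankPotential K L) :=
  continuous_finsetSum _ fun i _ =>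
    (continuous_logPotential (hKo i).measurableSet (hKb i)).comp (L i).continuous

theorem plankPotential_le (hKo : ∀ i, IsOpen (K i)) (hL : ∀ i z, ‖L i z‖ ≤ ‖z‖) {M : ℝ}
    (hM : 1 ≤ M) (hKM : ∀ i, K i ⊆ closedBall 0 M) (z : E) :
    plankPotential K L z ≤ (∑ i, volume.real (K i)) * Real.log (‖z‖ + M) := by
  rw [Finset.sum_mul]
  refine Finset.sum_le_sum fun i _ => ?_
  have h0 := norm_nonneg (L i z)
  refine (logPotential_le (hKo i).measurableSet (hKM i) _ (by linarith)).trans ?_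
  gcongr
  exact hL i z

theorem tendsto_plankPotential_sub_barrier [ProperSpace E] (hKo : ∀ i, IsOpen (K i))
    (hL : ∀ i z, ‖L i z‖ ≤ ‖z‖) {M : ℝ} (hM : 1 ≤ M) (hKM : ∀ i, K i ⊆ closedBall 0 M)
    {R B B' : ℝ} (hR : 0 < R) (hB' : ∑ i, volume.real (K i) < B') (hB : B' ≤ B) :
    Tendsto (fun z : E => 2 * plankPotential K L z - barrier B B' (‖z‖ ^ 2 / R ^ 2))
      (cocompact E) atBot := by
  set A := ∑ i, volume.real (K i) with hA
  have hA0 : 0 ≤ A := Finset.sum_nonneg fun _ _ => measureReal_nonneg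
  have hlog : Tendsto (fun z : E => -(2 * (B' - A)) * Real.log ‖z‖ +
      (2 * A * Real.log 2 + 2 * B' * Real.log R)) (cocompact E) atBot := by
    refine tendsto_atBot_add_const_right _ _ ?_
    exact (Real.tendsto_log_atTop.comp (tendsto_norm_cocompact_atTop (E := E))).const_mul_atTop_of_neg
      (by linarith)
  refine tendsto_atBot_mono' _ ?_ hlog
  filter_upwards [(tendsto_norm_cocompact_atTop (E := E)).eventually_ge_atTop (max M R)] with z hz
  have hzM : M ≤ ‖z‖ := (le_max_left _ _).trans hz
  have hzR : R ≤ ‖z‖ := (le_max_right _ _).trans hz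
  have hz0 : 0 < ‖z‖ := by linarith
  have hq : 1 ≤ ‖z‖ ^ 2 / R ^ 2 := by
    rw [one_le_div (by positivity)]; gcongr
  have h1 := plankPotential_le hKo hL hM hKM z
  have h2 : Real.log (‖z‖ + M) ≤ Real.log 2 + Real.log ‖z‖ := by
    rw [← Real.log_mul two_ne_zero hz0.ne']
    exact Real.log_le_log (by linarith) (by linarith)
  have h3 := mul_le_mul_of_nonneg_left h2 hA0
  have h4 : 0 ≤ (B - B') * (1 - (‖z‖ ^ 2 / R ^ 2)⁻¹) :=
    mul_nonneg (by linarith) (by simpa using inv_le_one_of_one_le₀ hq)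
  rw [barrier_of_one_le hq, Real.log_div (by positivity) (by positivity), Real.log_pow,
    Real.log_pow]
  push_cast
  nlinarith

/-- At a maximum point in the ball lying inside a plank, the average over small circles in the
direction transversal to this plank contradicts maximality, as `B < π R ^ 2`. -/
theorem notMem_of_forall_le_of_norm_le (hKo : ∀ i, IsOpen (K i))
    (hKb : ∀ i, Bornology.IsBounded (K i)) {R B B' : ℝ} (hR : 0 < R) (hB'0 : 0 ≤ B')
    (hB : B' ≤ B) (hBR : B < Real.pi * R ^ 2) {z₀ : E}
    (hmax : ∀ z, 2 * plankPotential K L z - barrier B B' (‖z‖ ^ 2 / R ^ 2) ≤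
      2 * plankPotential K L z₀ - barrier B B' (‖z₀‖ ^ 2 / R ^ 2))
    (hz₀ : ‖z₀‖ ≤ R) (i : ι) {v : E} (hv : ‖v‖ = 1) (hLv : L i v = 1) :
    L i z₀ ∉ K i := by
  classical
  intro hi
  obtain ⟨s, hs, hsK⟩ := Metric.nhds_basis_closedBall.mem_iff.mp ((hKo i).mem_nhds hi)
  have hcont (j : ι) : Continuous fun t : ℂ => logPotential (K j) (L j (z₀ + t • v)) :=
    (continuous_logPotential (hKo j).measurableSet (hKb j)).comp (by fun_prop)
  have hstrict : circleAverage (fun t : ℂ => logPotential (K i) (L i (z₀ + t • v))) 0 s =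
      logPotential (K i) (L i z₀) + Real.pi * s ^ 2 / 2 := by
    rw [← circleAverage_logPotential_add (hKo i).measurableSet (hKb i) hs hsK]
    simp [hLv]
  have hsub (j : ι) : logPotential (K j) (L j z₀) ≤
      circleAverage (fun t : ℂ => logPotential (K j) (L j (z₀ + t • v))) 0 s := by
    refine logPotential_le_circleAverage_comp (hKo j).measurableSet (hKb j)
      ((by fun_prop : Continuous fun t : ℂ => L j (z₀ + t • v)).comp (by fun_prop)) fun w hw => ?_
    have := log_norm_le_circleAverage (f := fun t : ℂ => L j (z₀ + t • v) - w) (c := 0) hs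
      (fun t _ => by simp only [map_add, map_smul, smul_eq_mul]; fun_prop) (by simpa using hw)
    simpa using this
  have hlow : plankPotential K L z₀ + Real.pi * s ^ 2 / 2 ≤
      circleAverage (fun t : ℂ => plankPotential K L (z₀ + t • v)) 0 s := by
    simp only [plankPotential]
    rw [Real.circleAverage_fun_sum fun j _ => (hcont j).continuousOn.circleIntegrable',
      ← Finset.add_sum_erase _ _ (Finset.mem_univ i),
      ← Finset.add_sum_erase _ _ (Finset.mem_univ i), hstrict]
    have := Finset.sum_le_sum fun j (_ : j ∈ Finset.univ.erase i) => hsub j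
    linarith
  have hup : circleAverage (fun t : ℂ => plankPotential K L (z₀ + t • v)) 0 s ≤
      circleAverage (fun t : ℂ => (plankPotential K L z₀ - B / 2 * (‖z₀‖ ^ 2 / R ^ 2)) +
        (B / 2 / R ^ 2) • ‖z₀ + t • v‖ ^ 2) 0 s := by
    refine Real.circleAverage_mono
      ((continuous_plankPotential hKo hKb).comp
        (by fun_prop : Continuous fun t : ℂ => z₀ + t • v)).continuousOn.circleIntegrable'
      (Continuous.continuousOn (by fun_prop)).circleIntegrable' fun t _ => ?_
    have h1 := hmax (z₀ + t • v)
    -- The point `z₀ + t • v` may lie outside the ball, where `barrier` is still at most `B * q`.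
    have h2 := barrier_le_mul hB'0 hB (‖z₀ + t • v‖ ^ 2 / R ^ 2)
    have hq : ‖z₀‖ ^ 2 / R ^ 2 ≤ 1 := by
      rw [div_le_one (by positivity)]; gcongr
    rw [barrier_of_le_one hq] at h1
    have h3 : B / 2 / R ^ 2 * ‖z₀ + t • v‖ ^ 2 = B * (‖z₀ + t • v‖ ^ 2 / R ^ 2) / 2 := by ring
    simp only [smul_eq_mul]
    linarith
  rw [Real.circleAverage_fun_add (circleIntegrable_const _ _ _)
    (Continuous.continuousOn (by fun_prop)).circleIntegrable', Real.circleAverage_const,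
    Real.circleAverage_fun_smul, circleAverage_norm_add_smul_sq, hv, smul_eq_mul] at hup
  have h1 : B / 2 / R ^ 2 * (‖z₀‖ ^ 2 + s ^ 2 * 1 ^ 2) =
      B / 2 * (‖z₀‖ ^ 2 / R ^ 2) + B / R ^ 2 * s ^ 2 / 2 := by ring
  have h2 : B / R ^ 2 < Real.pi := by rwa [div_lt_iff₀ (by positivity)]
  have h3 := mul_lt_mul_of_pos_right h2 (show 0 < s ^ 2 by positivity)
  linarith

/-- A maximum point lies in the ball: outside, `barrier` is strictly superharmonic along the
analytic discs `t ↦ (1 + t)⁻¹ • z₀`, on which `plankPotential` is subharmonic. -/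
theorem norm_le_of_forall_le (hKo : ∀ i, IsOpen (K i))
    (hKb : ∀ i, Bornology.IsBounded (K i)) {R B B' : ℝ} (hR : 0 < R)
    (hB : B' < B) {z₀ : E}
    (hmax : ∀ z, 2 * plankPotential K L z - barrier B B' (‖z‖ ^ 2 / R ^ 2) ≤
      2 * plankPotential K L z₀ - barrier B B' (‖z₀‖ ^ 2 / R ^ 2)) : ‖z₀‖ ≤ R := by
  by_contra! hz₀
  set q := ‖z₀‖ ^ 2 / R ^ 2 with hq
  have hz0 : 0 < ‖z₀‖ := hR.trans hz₀
  have hq1 : 1 ≤ q := by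
    rw [one_le_div (by positivity)]; gcongr
  have hq0 : 0 < q := by linarith
  -- The circle is small enough for the disc to stay outside the ball of radius `R`.
  obtain ⟨s, hs, hs1, hsR⟩ : ∃ s : ℝ, 0 < s ∧ s < 1 ∧ (1 + s) * R ≤ ‖z₀‖ := by
    refine ⟨min (1 / 2) (‖z₀‖ / R - 1), lt_min (by norm_num) ?_, ?_, ?_⟩
    · rwa [sub_pos, one_lt_div hR]
    · exact (min_le_left _ _).trans_lt (by norm_num)
    · rw [← le_div_iff₀ hR]
      linarith [min_le_right (1 / 2) (‖z₀‖ / R - 1)]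
  have hne : ∀ t ∈ closedBall (0 : ℂ) |s|, 1 + t ≠ 0 := by
    intro t ht h
    have : ‖t‖ ≤ s := by simpa [abs_of_pos hs] using ht
    rw [← neg_eq_of_add_eq_zero_right h, norm_neg, norm_one] at this
    linarith
  have hne' (t : ℂ) (ht : t ∈ sphere (0 : ℂ) |s|) : 1 + t ≠ 0 :=
    hne t (sphere_subset_closedBall ht)
  have hγ : ContinuousOn (fun t : ℂ => (1 + t)⁻¹ • z₀) (sphere 0 |s|) :=
    ((by fun_prop : Continuous fun t : ℂ => 1 + t).continuousOn.inv₀ hne').smul continuousOn_const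
  have hcont (j : ι) : ContinuousOn (fun t : ℂ => logPotential (K j) (L j ((1 + t)⁻¹ • z₀)))
      (sphere 0 |s|) :=
    ((continuous_logPotential (hKo j).measurableSet (hKb j)).comp
      (L j).continuous).comp_continuousOn hγ
  have hsub (j : ι) : logPotential (K j) (L j z₀) ≤
      circleAverage (fun t : ℂ => logPotential (K j) (L j ((1 + t)⁻¹ • z₀))) 0 s := by
    refine logPotential_le_circleAverage_comp (hKo j).measurableSet (hKb j) ?_ fun w hw => ?_
    · exact ((L j).continuous.comp_continuousOn hγ).comp_continuous (continuous_circleMap 0 s)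
        (circleMap_mem_sphere' 0 s)
    have := log_norm_le_circleAverage (f := fun t : ℂ => L j ((1 + t)⁻¹ • z₀) - w) (c := 0) hs
      (fun t ht => by
        have := hne t ht
        simp only [map_smul, smul_eq_mul]
        fun_prop (disch := assumption)) (by simpa using hw)
    simpa using this
  have hlow : plankPotential K L z₀ ≤
      circleAverage (fun t : ℂ => plankPotential K L ((1 + t)⁻¹ • z₀)) 0 s := by
    simp only [plankPotential]
    rw [Real.circleAverage_fun_sum fun j _ => (hcont j).circleIntegrable']
    exact Finset.sum_le_sum fun j _ => hsub j
  have hlogc : CircleIntegrable (fun t : ℂ => Real.log ‖1 + t‖) 0 s :=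
    (ContinuousOn.log (by fun_prop) fun t ht => norm_ne_zero_iff.mpr (hne' t ht)).circleIntegrable'
  have hsqc : CircleIntegrable (fun t : ℂ => ‖1 + t • (1 : ℂ)‖ ^ 2) 0 s :=
    (Continuous.continuousOn (by fun_prop)).circleIntegrable'
  have hlogc' : CircleIntegrable (fun t : ℂ => (-B') • Real.log ‖1 + t‖) 0 s := hlogc.const_smul
  have hsqc' : CircleIntegrable
      (fun t : ℂ => (-((B - B') / 2 * q⁻¹)) • ‖1 + t • (1 : ℂ)‖ ^ 2) 0 s := hsqc.const_smul
  have hsumc : CircleIntegrable (fun t : ℂ => (-B') • Real.log ‖1 + t‖ +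
      (-((B - B') / 2 * q⁻¹)) • ‖1 + t • (1 : ℂ)‖ ^ 2) 0 s := hlogc'.add hsqc'
  have hup : circleAverage (fun t : ℂ => plankPotential K L ((1 + t)⁻¹ • z₀)) 0 s ≤
      circleAverage (fun t : ℂ => (plankPotential K L z₀ + (B - B') / 2 * q⁻¹) +
        ((-B') • Real.log ‖1 + t‖ + (-((B - B') / 2 * q⁻¹)) • ‖1 + t • (1 : ℂ)‖ ^ 2)) 0 s := by
    refine Real.circleAverage_mono
      ((continuous_plankPotential hKo hKb).comp_continuousOn hγ).circleIntegrable' ?_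
      fun t ht => ?_
    · exact (circleIntegrable_const _ _ _).add hsumc
    have ht0 : 0 < ‖1 + t‖ := norm_pos_iff.mpr (hne' t ht)
    have hts : ‖1 + t‖ ≤ 1 + s := by
      have : ‖t‖ = s := by simpa [abs_of_pos hs] using ht
      simpa [this] using norm_add_le 1 t
    have hqt : ‖(1 + t)⁻¹ • z₀‖ ^ 2 / R ^ 2 = q / ‖1 + t‖ ^ 2 := by
      rw [norm_smul, norm_inv, hq]; field_simp
    have hqt1 : 1 ≤ q / ‖1 + t‖ ^ 2 := by
      rw [hq, div_div, one_le_div (by positivity), ← mul_pow]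
      gcongr
      nlinarith
    have h1 := hmax ((1 + t)⁻¹ • z₀)
    rw [hqt, barrier_of_one_le hqt1, barrier_of_one_le hq1,
      Real.log_div hq0.ne' (by positivity), Real.log_pow, inv_div] at h1
    have h2 : (B - B') * (1 - ‖1 + t‖ ^ 2 / q) = (B - B') - (B - B') * q⁻¹ * ‖1 + t‖ ^ 2 := by
      ring
    rw [h2] at h1
    push_cast at h1
    simp only [smul_eq_mul, mul_one]
    linarith
  rw [Real.circleAverage_fun_add (circleIntegrable_const _ _ _) hsumc,
    Real.circleAverage_const,
    Real.circleAverage_fun_add hlogc' hsqc', Real.circleAverage_fun_smul,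
    Real.circleAverage_fun_smul, circleAverage_log_norm_one_add hs hs1,
    circleAverage_norm_add_smul_sq, norm_one] at hup
  simp only [smul_eq_mul] at hup
  have h3 : 0 < (B - B') / 2 * q⁻¹ * s ^ 2 := by
    have := sub_pos.mpr hB
    positivity
  linarith

/-- Finitely many planks with open bounded cross-sections of total area less than `π R ^ 2` do not
cover the ball of radius `R`. -/
theorem exists_forall_notMem [ProperSpace E] (hKo : ∀ i, IsOpen (K i))
    (hKb : ∀ i, Bornology.IsBounded (K i)) (hL : ∀ i z, ‖L i z‖ ≤ ‖z‖)
    (hv : ∀ i, ∃ v, ‖v‖ = 1 ∧ L i v = 1) {R : ℝ} (hR : 0 < R)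
    (hA : ∑ i, volume.real (K i) < Real.pi * R ^ 2) :
    ∃ z : E, ‖z‖ ≤ R ∧ ∀ i, L i z ∉ K i := by
  have hA0 : 0 ≤ ∑ i, volume.real (K i) := Finset.sum_nonneg fun _ _ => measureReal_nonneg
  obtain ⟨B, hAB, hBR⟩ := exists_between hA
  obtain ⟨B', hAB', hB⟩ := exists_between hAB
  obtain ⟨M, hM, hKM⟩ : ∃ M : ℝ, 1 ≤ M ∧ ∀ i, K i ⊆ closedBall 0 M := by
    obtain ⟨M, hM⟩ := (Bornology.isBounded_iUnion.mpr hKb).subset_closedBall (0 : ℂ)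
    exact ⟨max M 1, le_max_right _ _, fun i => (subset_iUnion K i).trans
      (hM.trans (closedBall_subset_closedBall (le_max_left _ _)))⟩
  have hcont : Continuous fun z : E =>
      2 * plankPotential K L z - barrier B B' (‖z‖ ^ 2 / R ^ 2) :=
    ((continuous_plankPotential hKo hKb).const_mul 2).sub
      ((continuous_barrier B B').comp (by fun_prop))
  obtain ⟨z₀, hz₀⟩ := hcont.exists_forall_ge
    (tendsto_plankPotential_sub_barrier hKo hL hM hKM hR hAB' hB.le)
  have hz₀R := norm_le_of_forall_le hKo hKb hR hB hz₀
  refine ⟨z₀, hz₀R, fun i => ?_⟩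
  obtain ⟨v, hv1, hv2⟩ := hv i
  exact notMem_of_forall_le_of_norm_le hKo hKb hR (hA0.trans hAB'.le) hB.le hBR hz₀ hz₀R i hv1 hv2

end Planks

/-! ### Covering the ball by unitary planks -/

theorem mem_unitaryPlank_iff {d : ℕ} [NeZero d]
    {U : EuclideanSpace ℂ (Fin d) ≃ₗᵢ[ℂ] EuclideanSpace ℂ (Fin d)} {K : Set ℂ}
    {z : EuclideanSpace ℂ (Fin d)} : z ∈ unitaryPlank U K ↔ U.symm z 0 ∈ K := by
  constructor
  · rintro ⟨x, hx, rfl⟩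
    simpa [standardPlank] using hx
  · exact fun h => ⟨U.symm z, h, by simp⟩

/-- The linear functional whose preimage of `K` is `unitaryPlank U K`. -/
noncomputable def plankFunctional {d : ℕ} [NeZero d]
    (U : EuclideanSpace ℂ (Fin d) ≃ₗᵢ[ℂ] EuclideanSpace ℂ (Fin d)) :
    EuclideanSpace ℂ (Fin d) →L[ℂ] ℂ :=
  (EuclideanSpace.proj 0).comp (U.symm : EuclideanSpace ℂ (Fin d) →L[ℂ] EuclideanSpace ℂ (Fin d))

theorem plankFunctional_apply {d : ℕ} [NeZero d]
    (U : EuclideanSpace ℂ (Fin d) ≃ₗᵢ[ℂ] EuclideanSpace ℂ (Fin d))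
    (z : EuclideanSpace ℂ (Fin d)) : plankFunctional U z = U.symm z 0 := rfl

theorem norm_plankFunctional_le {d : ℕ} [NeZero d]
    (U : EuclideanSpace ℂ (Fin d) ≃ₗᵢ[ℂ] EuclideanSpace ℂ (Fin d))
    (z : EuclideanSpace ℂ (Fin d)) : ‖plankFunctional U z‖ ≤ ‖z‖ := by
  rw [plankFunctional_apply, ← U.symm.norm_map z]
  exact PiLp.norm_apply_le _ 0

theorem exists_plankFunctional_eq_one {d : ℕ} [NeZero d]
    (U : EuclideanSpace ℂ (Fin d) ≃ₗᵢ[ℂ] EuclideanSpace ℂ (Fin d)) :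
    ∃ v, ‖v‖ = 1 ∧ plankFunctional U v = 1 :=
  ⟨U (EuclideanSpace.single 0 1), by simp, by simp [plankFunctional_apply]⟩

/-- The covering inequality for open cross-sections: compactness reduces it to finitely many
planks, and the cross-sections may be cut down to a disc. -/
theorem ofReal_le_tsum_volume_of_isOpen {d : ℕ} [NeZero d] {R : ℝ} (hR : 0 < R) {ι : Type*}
    (U : ι → (EuclideanSpace ℂ (Fin d) ≃ₗᵢ[ℂ] EuclideanSpace ℂ (Fin d)))
    {K : ι → Set ℂ} (hK : ∀ i, IsOpen (K i))
    (hcover : closedBall (0 : EuclideanSpace ℂ (Fin d)) R ⊆ ⋃ i, unitaryPlank (U i) (K i)) :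
    ENNReal.ofReal (Real.pi * R ^ 2) ≤ ∑' i, volume (K i) := by
  have hopen (i : ι) : IsOpen (unitaryPlank (U i) (K i)) := by
    have : unitaryPlank (U i) (K i) = plankFunctional (U i) ⁻¹' K i := by
      ext z
      rw [mem_unitaryPlank_iff, mem_preimage, plankFunctional_apply]
    rw [this]
    exact (hK i).preimage (plankFunctional (U i)).continuous
  obtain ⟨F, hF⟩ := (isCompact_closedBall (0 : EuclideanSpace ℂ (Fin d)) R).elim_finite_subcover
    _ hopen hcover
  refine le_trans ?_ (ENNReal.sum_le_tsum F)
  by_contra! hlt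
  -- On the ball the functionals take values of norm at most `R`.
  let K' : F → Set ℂ := fun i => K i ∩ ball 0 (R + 1)
  have hb (i : F) : Bornology.IsBounded (K' i) := isBounded_ball.subset inter_subset_right
  have hsum : ∑ i, volume.real (K' i) < Real.pi * R ^ 2 := by
    have h1 : ∑ i, volume (K' i) < ENNReal.ofReal (Real.pi * R ^ 2) := by
      refine lt_of_le_of_lt ?_ hlt
      rw [← Finset.sum_coe_sort F]
      exact Finset.sum_le_sum fun i _ => measure_mono inter_subset_left
    have h2 : ∑ i, volume.real (K' i) = (∑ i, volume (K' i)).toReal :=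
      (ENNReal.toReal_sum fun i _ => (hb i).measure_lt_top.ne).symm
    rw [h2]
    exact (ENNReal.lt_ofReal_iff_toReal_lt h1.ne_top).mp h1
  obtain ⟨z, hzR, hz⟩ := exists_forall_notMem (L := fun i : F => plankFunctional (U i))
    (fun i => (hK i).inter isOpen_ball) hb (fun i => norm_plankFunctional_le (U i))
    (fun i => exists_plankFunctional_eq_one (U i)) hR hsum
  obtain ⟨i, hiF, hi⟩ := mem_iUnion₂.mp (hF (mem_closedBall_zero_iff.mpr hzR))
  refine hz ⟨i, hiF⟩ ⟨mem_unitaryPlank_iff.mp hi, ?_⟩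
  rw [mem_ball_zero_iff]
  linarith [norm_plankFunctional_le (U i) z]

theorem corollary5 (d : ℕ) [NeZero d] (R : ℝ) (hR : 0 < R)
    {ι : Type*} [Countable ι]
    (U : ι → (EuclideanSpace ℂ (Fin d) ≃ₗᵢ[ℂ] EuclideanSpace ℂ (Fin d)))
    (K : ι → Set ℂ)
    (hK : ∀ i, MeasureTheory.NullMeasurableSet (K i) MeasureTheory.volume)
    (hcover : Metric.closedBall (0 : EuclideanSpace ℂ (Fin d)) R ⊆
      ⋃ i, unitaryPlank (U i) (K i)) :
    ENNReal.ofReal (Real.pi * R ^ 2) ≤ ∑' i, MeasureTheory.volume (K i) := by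
  refine le_of_forall_pos_le_add fun ε hε => ?_
  obtain ⟨δ, hδ, hδε⟩ := ENNReal.exists_pos_sum_of_countable' hε.ne' ι
  have hex (i : ι) : ∃ V ⊇ K i, IsOpen V ∧ volume V ≤ volume (K i) + δ i :=
    (K i).exists_isOpen_le_add volume (hδ i).ne'
  choose V hKV hVo hV using hex
  calc ENNReal.ofReal (Real.pi * R ^ 2) ≤ ∑' i, volume (V i) :=
        ofReal_le_tsum_volume_of_isOpen hR U hVo
          (hcover.trans (iUnion_mono fun i => image_mono fun x hx => hKV i hx))
    _ ≤ ∑' i, (volume (K i) + δ i) := ENNReal.tsum_le_tsum hV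
    _ = ∑' i, volume (K i) + ∑' i, δ i := ENNReal.tsum_add
    _ ≤ ∑' i, volume (K i) + ε := by gcongr
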